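/- \textbf{Definitions.} Let $M$ be a monoid. For a non-empty finite set $D$, let $\mathrm{Map}(D)$ be the set of all maps $D\to D$ and let $d_D(f,g)=\frac1{|D|}|\{v\in D: f(v)\neq g(v)\}|$ for $f,g\in\mathrm{Map}(D)$. $M$ is \emph{strongly sofic} if for every finite $K\subset M$ there is an integer $\Delta_K\ge 1$ such that for every $\varepsilon>0$ there are a non-empty finite set $D$ and a map $\sigma\colon M\to\mathrm{Map}(D)$ with $\sigma(1_M)=\mathrm{Id}_D$; $d_D(\sigma(k_1k_2),\sigma(k_1)\sigma(k_2))\le\varepsilon$ for all $k_1,k_2\in K$; $d_D(\sigma(k_1),\sigma(k_2))\ge 1-\varepsilon$ for all distinct $k_1,k_2\in K$; and $|\sigma(k)^{-1}(v)|\le\Delta_K$ for all $k\in K$, $v\in D$. A \emph{strong sofic approximation} of $M$ is a net $\Sigma=(D_i,\sigma_i)_{i\in I}$ indexed by a (non-empty) directed set $I$, where $D_i$ is a non-empty finite set and $\sigma_i\colon M\to\mathrm{Map}(D_i)$ is a map, such that $\sigma_i(1_M)=\mathrm{Id}_{D_i}$ for all $i$; $\lim_i d_{D_i}(\sigma_i(m_1m_2),\sigma_i(m_1)\sigma_i(m_2))=0$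 for all $m_1,m_2\in M$; $\lim_i d_{D_i}(\sigma_i(m_1),\sigma_i(m_2))=1$ for all distinct $m_1,m_2\in M$; and for every finite $K\subset M$ there is an integer $\Delta_K\geq 1$ with $|\sigma_i(k)^{-1}(v)|\le\Delta_K$ for all $i\in I$, $k\in K$, $v\in D_i$. An action of $M$ on a topological space $X$ is \emph{continuous} if $x\mapsto mx$ is continuous for every $m\in M$. Let $X$ be a compact topological space with a continuous action of $M$. A \emph{continuous pseudometric} on $X$ is a pseudometric $\rho\colon X\times X\to\mathbb R$ that is continuous on $X\times X$; it is \emph{dynamically generating} for $(X,M)$ if for all distinct $x,y\in X$ there is $m\in M$ with $\rho(mx,my)>0$. For $\varphi,\psi\in X^D$ put $$\rho_2^D(\varphi,\psi)=\Big(\tfrac1{|D|}\sum_{v\in D}\rho(\varphi(v),\psi(v))^2\Big)^{1/2},\qquad \rho_\infty^D(\varphi,\psi)=\max_{v\in D}\rho(\varphi(v),\psi(v)).$$ For a finite $F\subset M$, $\delta>0$ and $\sigma\colon M\to\mathrm{Map}(D)$ let $$\mathrm{Map}(X,M,\rho,F,\delta,\sigma)=\{\varphi\in X^D:\ \rho_2^D(\varphi\circ\sigma(m),m\varphi)\le\delta\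 \text{ for all } m\in F\},$$ where $(m\varphi)(v)=m\varphi(v)$. For a pseudometric $d$ on a set containing $A$, let $N_\varepsilon(A,d)$ be the maximal cardinality of a subset $Z\subset A$ with $d(x,y)\ge\varepsilon$ for all distinct $x,y\in Z$. For a strong sofic approximation $\Sigma=(D_i,\sigma_i)_{i\in I}$ put, with $\log 0=-\infty$, $$h_\Sigma(X,M,\rho)=\sup_{\varepsilon>0}\ \inf_{F\subset M\text{ finite}}\ \inf_{\delta>0}\ \limsup_{i\in I}\frac1{|D_i|}\log N_\varepsilon\big(\mathrm{Map}(X,M,\rho,F,\delta,\sigma_i),\rho_\infty^{D_i}\big)\in[-\infty,\infty].$$ If $(X,M)$ admits a dynamically generating continuous pseudometric, put $h_\Sigma(X,M)=h_\Sigma(X,M,\rho)$ for some such $\rho$; part (2) of the theorem says that the choice of $\rho$ does not matter. $(X,M)$ and $(Y,M)$ are \emph{topologically conjugate} if there is an $M$-equivariant homeomorphism $X\to Y$. \textbf{Theorem.} Let $M$ be an infinite strongly sofic monoid, and let $X$ and $Y$ be compact topological spaces equipped with continuous actions of $M$. Suppose that $(X,M)$ and $(Y,M)$ are topologically conjugate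 and that $(X,M)$ admits a dynamically generating continuous pseudometric. Then: (1) $(Y,M)$ admits a dynamically generating continuous pseudometric. (2) For every strong sofic approximation $\Sigma$ of $M$ one has $h_\Sigma(X,M,\rho)=h_\Sigma(X,M)$ for every dynamically generating continuous pseudometric $\rho$ for $(X,M)$, and $h_\Sigma(Y,M,\rho)=h_\Sigma(Y,M)$ for every dynamically generating continuous pseudometric $\rho$ for $(Y,M)$. (3) For every strong sofic approximation $\Sigma$ of $M$ one has $h_\Sigma(X,M)=h_\Sigma(Y,M)$. -/

import Mathlib

open Filter Topology

universe uM uX uY uI uD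

/-! ### Pseudometrics, separated sets, dynamically generating pseudometrics -/

/-- `ρ : X → X → ℝ` is a pseudometric on the set `X`. -/
structure IsPseudometric {X : Type uX} (ρ : X → X → ℝ) : Prop where
  self_eq_zero : ∀ x, ρ x x = 0
  symmetric : ∀ x y, ρ x y = ρ y x
  triangle : ∀ x y z, ρ x y ≤ ρ x z + ρ z y

/-- `ρ` is a pseudometric on `X` which is continuous as a map `X × X → ℝ`. -/
structure IsContinuousPseudometric {X : Type uX} [TopologicalSpace X] (ρ : X → X → ℝ) : Prop
    extends IsPseudometric ρ where
  continuous : Continuous fun p : X × X => ρ p.1 p.2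

/-- For all distinct points `x, y` of `X` there is `m ∈ M` with `ρ (m x) (m y) > 0`. -/
def IsDynamicallyGenerating (M : Type uM) {X : Type uX} [Monoid M] [MulAction M X]
    (ρ : X → X → ℝ) : Prop :=
  ∀ x y : X, x ≠ y → ∃ m : M, 0 < ρ (m • x) (m • y)

/-- `ρ` is a dynamically generating continuous pseudometric for `(X, M)`. -/
structure IsGenPseudometric (M : Type uM) {X : Type uX} [Monoid M] [TopologicalSpace X]
    [MulAction M X] (ρ : X → X → ℝ) : Prop extends IsContinuousPseudometric ρ where
  generating : IsDynamicallyGenerating M ρ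

/-- `(X, M)` admits a dynamically generating continuous pseudometric. -/
def AdmitsGenPseudometric (M : Type uM) (X : Type uX) [Monoid M] [TopologicalSpace X]
    [MulAction M X] : Prop :=
  ∃ ρ : X → X → ℝ, IsGenPseudometric M ρ

/-- `Z` is `(ρ, ε)`-separated: `ρ x y ≥ ε` for all distinct `x, y ∈ Z`. -/
def IsSeparatedFor {X : Type uX} (ρ : X → X → ℝ) (ε : ℝ) (Z : Set X) : Prop :=
  Z.Pairwise fun x y => ε ≤ ρ x y

/-- The maximal cardinality `N_ε(A, ρ)` of a `(ρ, ε)`-separated subset of `A`. -/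
noncomputable def sepNumber {X : Type uX} (A : Set X) (ρ : X → X → ℝ) (ε : ℝ) : ℕ∞ :=
  ⨆ (Z : Set X) (_ : Z ⊆ A) (_ : IsSeparatedFor ρ ε Z), Z.encard

/-! ### Topological conjugacy -/

/-- There is an `M`-equivariant homeomorphism from `X` onto `Y`. -/
def TopologicallyConjugate (M : Type uM) (X : Type uX) (Y : Type uY) [Monoid M]
    [TopologicalSpace X] [MulAction M X] [TopologicalSpace Y] [MulAction M Y] : Prop :=
  ∃ f : X ≃ₜ Y, ∀ (m : M) (x : X), f (m • x) = m • f x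

/-! ### Strong soficity -/

open Classical in
/-- The normalized Hamming metric on the set of all maps `D → D`. -/
noncomputable def hamDist {D : Type uD} [Fintype D] (f g : D → D) : ℝ :=
  (hammingDist f g : ℝ) / (Fintype.card D : ℝ)

/-- Strongly sofic monoids. -/
def StronglySofic (M : Type uM) [Monoid M] : Prop :=
  ∀ K : Finset M, ∃ Δ : ℕ, 1 ≤ Δ ∧ ∀ ε : ℝ, 0 < ε →
    ∃ (D : Type) (_ : Fintype D) (_ : Nonempty D) (σ : M → D → D),
      σ 1 = id ∧
      (∀ k₁ ∈ K, ∀ k₂ ∈ K, hamDist (σ (k₁ * k₂)) (σ k₁ ∘ σ k₂) ≤ ε) ∧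
      (∀ k₁ ∈ K, ∀ k₂ ∈ K, k₁ ≠ k₂ → 1 - ε ≤ hamDist (σ k₁) (σ k₂)) ∧
      (∀ k ∈ K, ∀ v : D, (σ k ⁻¹' {v}).ncard ≤ Δ)

/-- A family `(D i, σ i)` indexed by `i ∈ I`, where `D i` is a non-empty finite set and
`σ i` is a map from `M` to the set of all maps `D i → D i`. -/
structure SoficNet (M : Type uM) (I : Type uI) where
  D : I → Type uD
  [fintypeD : ∀ i, Fintype (D i)]
  [nonemptyD : ∀ i, Nonempty (D i)]
  σ : ∀ i, M → D i → D i

attribute [instance] SoficNet.fintypeD SoficNet.nonemptyD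

/-- The net `S`, indexed by the directed set `I`, is a strong sofic approximation of `M`. -/
structure SoficNet.IsStrongSoficApproximation {M : Type uM} [Monoid M] {I : Type uI} [Preorder I]
    (S : SoficNet.{uM, uI, uD} M I) : Prop where
  map_one : ∀ i, S.σ i 1 = id
  tendsto_mul : ∀ m₁ m₂ : M,
    Tendsto (fun i => hamDist (S.σ i (m₁ * m₂)) (S.σ i m₁ ∘ S.σ i m₂)) atTop (𝓝 0)
  tendsto_distinct : ∀ m₁ m₂ : M, m₁ ≠ m₂ →
    Tendsto (fun i => hamDist (S.σ i m₁) (S.σ i m₂)) atTop (𝓝 1)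
  fiber_bound : ∀ K : Finset M, ∃ Δ : ℕ, 1 ≤ Δ ∧
    ∀ (i : I), ∀ k ∈ K, ∀ v : S.D i, (S.σ i k ⁻¹' {v}).ncard ≤ Δ

/-! ### Sofic topological entropy -/

/-- The pseudometric `ρ_2^D` on `X^D`. -/
noncomputable def rhoTwo {X : Type uX} (D : Type uD) [Fintype D] (ρ : X → X → ℝ)
    (φ ψ : D → X) : ℝ :=
  Real.sqrt ((1 / (Fintype.card D : ℝ)) * ∑ v, ρ (φ v) (ψ v) ^ 2)

/-- The pseudometric `ρ_∞^D` on `X^D`. -/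
noncomputable def rhoInf {X : Type uX} (D : Type uD) [Fintype D] [Nonempty D] (ρ : X → X → ℝ)
    (φ ψ : D → X) : ℝ :=
  Finset.univ.sup' Finset.univ_nonempty fun v => ρ (φ v) (ψ v)

/-- The set `Map(X, M, ρ, F, δ, σ)` of all `φ : D → X` with
`ρ_2^D (φ ∘ σ(m), m φ) ≤ δ` for all `m ∈ F`. -/
def mapSet {M : Type uM} {X : Type uX} [Monoid M] [MulAction M X] {D : Type uD} [Fintype D]
    (ρ : X → X → ℝ) (F : Finset M) (δ : ℝ) (σ : M → D → D) : Set (D → X) :=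
  {φ | ∀ m ∈ F, rhoTwo D ρ (φ ∘ σ m) (fun v => m • φ v) ≤ δ}

/-- `h_Σ(X, M, ε, ρ, F, δ)`, with `log 0 = -∞`. -/
noncomputable def entropyAux {M : Type uM} {X : Type uX} [Monoid M] [MulAction M X]
    {I : Type uI} [Preorder I] (S : SoficNet.{uM, uI, uD} M I) (ρ : X → X → ℝ)
    (ε : ℝ) (F : Finset M) (δ : ℝ) : EReal :=
  limsup (fun i : I =>
    ENNReal.log (sepNumber (mapSet ρ F δ (S.σ i)) (rhoInf (S.D i) ρ) ε : ENNReal) /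
      (Fintype.card (S.D i) : EReal)) atTop

/-- The sofic topological entropy `h_Σ(X, M, ρ)` with respect to `Σ` and `ρ`. -/
noncomputable def relSoficEntropy {M : Type uM} {X : Type uX} [Monoid M] [MulAction M X]
    {I : Type uI} [Preorder I] (S : SoficNet.{uM, uI, uD} M I) (ρ : X → X → ℝ) : EReal :=
  ⨆ (ε : ℝ) (_ : 0 < ε), ⨅ (F : Finset M), ⨅ (δ : ℝ) (_ : 0 < δ), entropyAux S ρ ε F δ

/-- The sofic topological entropy `h_Σ(X, M) = h_Σ(X, M, ρ)`, where `ρ` is some dynamically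
generating continuous pseudometric for `(X, M)`, whose existence is the argument `hX`. -/
noncomputable def soficEntropy {M : Type uM} {X : Type uX} [Monoid M] [TopologicalSpace X]
    [MulAction M X] {I : Type uI} [Preorder I] (S : SoficNet.{uM, uI, uD} M I)
    (hX : AdmitsGenPseudometric M X) : EReal :=
  relSoficEntropy S hX.choose

/-!
When `ρ` and `ρ'` are dynamically generating, compactness makes two points close for one of them
as soon as finitely many of their translates are close for the other. Applied at most points of
`D` (Markov's inequality), this shows that every good approximate orbit for `ρ` is one for `ρ'`:
here asymptotic multiplicativity relates `φ ∘ σ (k * m)` to `φ ∘ σ k ∘ σ m`, and bounded fibres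
keep the exceptional sets small under composition with `σ m`. It also shows that approximate
orbits which are uniformly `ρ'`-close are `ρ`-close off a set of small density `θ`. A maximal
`ρ'`-separated set thus covers the approximate orbits by such near-neighbourhoods, and each of
them carries at most `exp (η * |D|)` points that are `ρ`-separated, by a volume bound for Hamming
balls, with `η → 0` as `θ → 0`. So passing from `ρ` to `ρ'` costs no entropy; invariance under
conjugacy follows by transporting a pseudometric along the homeomorphism.
-/

/-! ### Continuous pseudometrics on compact spaces -/

section CompactSpace

variable {X : Type uX} {ρ ρ' : X → X → ℝ} {ε : ℝ}

lemma IsPseudometric.nonneg (h : IsPseudometric ρ) (x y : X) : 0 ≤ ρ x y := by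
  have hxyx : ρ x x ≤ ρ x y + ρ y x := h.triangle x x y
  rw [h.self_eq_zero, h.symmetric y x] at hxyx
  linarith

variable [TopologicalSpace X] [CompactSpace X]

lemma IsContinuousPseudometric.exists_bound (h : IsContinuousPseudometric ρ) :
    ∃ C : ℝ, ∀ x y, ρ x y ≤ C := by
  obtain ⟨C, hC⟩ := isCompact_univ.bddAbove_image h.continuous.continuousOn
  exact ⟨C, fun x y => hC ⟨(x, y), Set.mem_univ _, rfl⟩⟩

lemma IsContinuousPseudometric.exists_finset_forall_exists_lt (h : IsContinuousPseudometric ρ)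
    (hε : 0 < ε) : ∃ t : Finset X, ∀ y, ∃ x ∈ t, ρ x y < ε := by
  have ball_mem_nhds (x : X) : {y | ρ x y < ε} ∈ 𝓝 x := by
    have hcont : Continuous fun y => ρ x y := h.continuous.comp (Continuous.prodMk_right x)
    exact (isOpen_lt hcont continuous_const).mem_nhds (by simpa [h.self_eq_zero] using hε)
  obtain ⟨t, -, ht⟩ := isCompact_univ.elim_nhds_subcover _ fun x _ => ball_mem_nhds x
  exact ⟨t, fun y => by simpa using ht (Set.mem_univ y)⟩

lemma IsContinuousPseudometric.exists_fin_coloring (h : IsContinuousPseudometric ρ)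
    (hε : 0 < ε) : ∃ (N : ℕ) (c : X → Fin N), ∀ x y, c x = c y → ρ x y < ε := by
  obtain ⟨t, ht⟩ := h.exists_finset_forall_exists_lt (half_pos hε)
  choose p hpt hp using ht
  refine ⟨t.card, fun x => t.equivFin ⟨p x, hpt x⟩, fun x y hxy => ?_⟩
  have hpxy : p x = p y := by simpa using hxy
  have hx : ρ x (p y) < ε / 2 := by simpa only [h.symmetric x, ← hpxy] using hp x
  linarith [h.triangle x y (p y), hp y]

variable {M : Type uM} [Monoid M] [MulAction M X] [ContinuousConstSMul M X]

lemma IsGenPseudometric.exists_finset_forall_smul_lt_imp_lt (h' : IsGenPseudometric M ρ')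
    (h : IsContinuousPseudometric ρ) (hε : 0 < ε) :
    ∃ (K : Finset M) (κ : ℝ), 0 < κ ∧
      ∀ x y, (∀ k ∈ K, ρ' (k • x) (k • y) < κ) → ρ x y < ε := by
  have hcont (m : M) : Continuous fun p : X × X => ρ' (m • p.1) (m • p.2) :=
    h'.continuous.comp (f := fun p : X × X => (m • p.1, m • p.2)) (by fun_prop)
  have far_compact : IsCompact {p : X × X | ε ≤ ρ p.1 p.2} :=
    (isClosed_le continuous_const h.continuous).isCompact
  obtain ⟨K, hK⟩ := far_compact.elim_finite_subcover
    (fun m : M => {p : X × X | 0 < ρ' (m • p.1) (m • p.2)})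
    (fun m => isOpen_lt continuous_const (hcont m)) fun p hp => by
      have hne : p.1 ≠ p.2 := fun heq => by
        rw [Set.mem_ofPred_eq, heq, h.self_eq_zero] at hp
        linarith
      simpa using h'.generating _ _ hne
  obtain ⟨κ, hκ, hle⟩ := far_compact.exists_forall_le' (a := 0)
    (continuous_finsetSum K fun m _ => hcont m).continuousOn fun p hp => by
      obtain ⟨m, hm, hpos⟩ := Set.mem_iUnion₂.1 (hK hp)
      exact Finset.sum_pos' (fun k _ => h'.nonneg _ _) ⟨m, hm, hpos⟩
  obtain ⟨τ, hτ, hτκ⟩ := exists_pos_mul_lt hκ K.card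
  refine ⟨K, τ, hτ, fun x y hxy => not_le.1 fun hfar => hτκ.not_ge ?_⟩
  calc κ ≤ ∑ k ∈ K, ρ' (k • x) (k • y) := hle (x, y) hfar
    _ ≤ K.card • τ := Finset.sum_le_card_nsmul _ _ _ fun k hk => (hxy k hk).le
    _ = K.card * τ := nsmul_eq_mul _ _

end CompactSpace

/-! ### Volume of Hamming balls -/

section HammingBall

open scoped Finset

variable {β : Type*} [Fintype β] [DecidableEq β]

/- Chernoff's method: in the expansion of `∏ v, ∑ b, t ^ [b ≠ g v]` over all `f : D → β`, every
`f` in the ball contributes at least `t ^ s`. -/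
lemma card_hammingDist_le_mul_rpow_le {D : Type*} [Fintype D] [DecidableEq D] (g : D → β)
    {t : ℝ} (ht : 0 < t) (ht₁ : t ≤ 1) (s : ℝ) :
    #{f : D → β | (hammingDist f g : ℝ) ≤ s} * t ^ s ≤
      (1 + Fintype.card β * t) ^ Fintype.card D := by
  have weight_eq (f : D → β) : ∏ v, (if f v ≠ g v then t else 1) = t ^ hammingDist f g := by
    simp [Finset.prod_ite, hammingDist]
  calc #{f : D → β | (hammingDist f g : ℝ) ≤ s} * t ^ s
      = ∑ f : D → β with (hammingDist f g : ℝ) ≤ s, t ^ s := by simp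
    _ ≤ ∑ f : D → β with (hammingDist f g : ℝ) ≤ s, t ^ hammingDist f g := by
        refine Finset.sum_le_sum fun f hf => ?_
        rw [← Real.rpow_natCast]
        exact Real.rpow_le_rpow_of_exponent_ge ht ht₁ (Finset.mem_filter.1 hf).2
    _ ≤ ∑ f : D → β, t ^ hammingDist f g :=
        Finset.sum_le_sum_of_subset_of_nonneg (Finset.subset_univ _) fun _ _ _ => by positivity
    _ = ∏ v, ∑ b, (if b ≠ g v then t else 1) := by
        simp only [← weight_eq, Fintype.prod_sum]
    _ ≤ ∏ _v : D, (1 + Fintype.card β * t) := by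
        refine Finset.prod_le_prod (fun v _ => by positivity) fun v _ => ?_
        calc ∑ b, (if b ≠ g v then t else 1) ≤ ∑ b, ((if b = g v then 1 else 0) + t) := by
              gcongr with b
              split_ifs <;> simp_all [ht.le]
          _ = 1 + Fintype.card β * t := by simp [Finset.sum_add_distrib]
    _ = (1 + Fintype.card β * t) ^ Fintype.card D := by simp

lemma exists_one_add_mul_le_exp_mul_rpow {b η : ℝ} (hη : 0 < η) :
    ∃ t θ : ℝ, 0 < t ∧ t ≤ 1 ∧ 0 < θ ∧ 1 + b * t ≤ Real.exp η * t ^ θ := by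
  obtain ⟨t, htη, ht₁, ht⟩ : ∃ t : ℝ, 1 + b * t < Real.exp η ∧ t ≤ 1 ∧ 0 < t := by
    have hlim : Tendsto (fun t : ℝ => 1 + b * t) (𝓝[>] 0) (𝓝 (1 + b * 0)) :=
      (by fun_prop : Continuous fun t : ℝ => 1 + b * t).tendsto' _ _ rfl |>.mono_left
        nhdsWithin_le_nhds
    have hlt : ∀ᶠ t in 𝓝[>] (0 : ℝ), 1 + b * t < Real.exp η :=
      hlim.eventually_lt_const (by simpa using hη)
    have hle : ∀ᶠ t in 𝓝[>] (0 : ℝ), t ≤ 1 := nhdsWithin_le_nhds (eventually_le_nhds one_pos)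
    exact (hlt.and (hle.and self_mem_nhdsWithin)).exists
  obtain ⟨θ, hθη, hθ⟩ : ∃ θ : ℝ, 1 + b * t < Real.exp η * t ^ θ ∧ 0 < θ := by
    have hlim : Tendsto (fun θ : ℝ => Real.exp η * t ^ θ) (𝓝[>] 0)
        (𝓝 (Real.exp η * t ^ (0 : ℝ))) :=
      ((Real.continuousAt_const_rpow ht.ne').tendsto.mono_left nhdsWithin_le_nhds).const_mul _
    exact ((hlim.eventually_const_lt (by simpa using htη)).and self_mem_nhdsWithin).exists
  exact ⟨t, θ, ht, ht₁, hθ, hθη.le⟩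

variable (β) in
lemma exists_card_hammingDist_le_le_exp {η : ℝ} (hη : 0 < η) :
    ∃ θ : ℝ, 0 < θ ∧ ∀ (D : Type uD) [Fintype D] [DecidableEq D] (g : D → β),
      (#{f : D → β | (hammingDist f g : ℝ) ≤ θ * Fintype.card D} : ℝ) ≤
        Real.exp (η * Fintype.card D) := by
  obtain ⟨t, θ, ht, ht₁, hθ, hle⟩ := exists_one_add_mul_le_exp_mul_rpow (b := Fintype.card β) hη
  refine ⟨θ, hθ, fun D _ _ g => ?_⟩
  have hpos : 0 < t ^ (θ * Fintype.card D) := Real.rpow_pos_of_pos ht _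
  refine le_of_mul_le_mul_right ?_ hpos
  calc #{f : D → β | (hammingDist f g : ℝ) ≤ θ * Fintype.card D} * t ^ (θ * Fintype.card D)
      ≤ (1 + Fintype.card β * t) ^ Fintype.card D :=
        card_hammingDist_le_mul_rpow_le g ht ht₁ _
    _ ≤ (Real.exp η * t ^ θ) ^ Fintype.card D := by gcongr
    _ = Real.exp (η * Fintype.card D) * t ^ (θ * Fintype.card D) := by
        rw [mul_pow, Real.rpow_mul_natCast ht.le, mul_comm η, Real.exp_nat_mul]

end HammingBall

/-! ### Separation numbers -/

section Separated

variable {X : Type uX} {A B : Set X} {d d' : X → X → ℝ} {ε ε' : ℝ}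

lemma sepNumber_mono (h : A ⊆ B) : sepNumber A d ε ≤ sepNumber B d ε :=
  iSup_mono fun _ => iSup_mono' fun hZ => ⟨hZ.trans h, le_rfl⟩

lemma encard_le_sepNumber {Z : Set X} (hZA : Z ⊆ A) (hZ : IsSeparatedFor d ε Z) :
    Z.encard ≤ sepNumber A d ε :=
  le_iSup_of_le Z (le_iSup₂_of_le hZA hZ le_rfl)

lemma sepNumber_le_of_forall_finset {R : ℕ∞}
    (h : ∀ Z : Finset X, (Z : Set X) ⊆ A → IsSeparatedFor d ε Z → (Z : Set X).encard ≤ R) :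
    sepNumber A d ε ≤ R := by
  refine iSup_le fun Z => iSup₂_le fun hZA hZ => ENat.forall_natCast_le_iff_le.1 fun n hn => ?_
  obtain ⟨T, hTZ, hT⟩ := Set.exists_subset_encard_eq hn
  lift T to Finset X using Set.finite_of_encard_eq_coe hT
  exact hT ▸ h T (hTZ.trans hZA) (hZ.mono hTZ)

lemma sepNumber_le_card_of_mapsTo {β : Type*} (code : X → β) (T : Finset β)
    (hmaps : Set.MapsTo code A T) (hcode : ∀ x y, code x = code y → d x y < ε) :
    sepNumber A d ε ≤ T.card := by
  refine iSup_le fun Z => iSup₂_le fun hZA hZ => ?_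
  rw [← Set.encard_coe_eq_coe_finsetCard]
  refine Set.encard_le_encard_of_injOn (hmaps.mono_left hZA) fun x hx y hy hxy => ?_
  by_contra hne
  exact (hZ hx hy hne).not_gt (hcode x y hxy)

lemma exists_subset_isSeparatedFor_forall_exists_lt (hself : ∀ x, d x x < ε)
    (hsymm : ∀ x y, d x y = d y x) (Z : Finset X) :
    ∃ W ⊆ Z, IsSeparatedFor d ε (W : Set X) ∧ ∀ z ∈ Z, ∃ w ∈ W, d z w < ε := by
  classical
  obtain ⟨W, hW⟩ :=
    (Z.powerset.filter fun W : Finset X => IsSeparatedFor d ε (W : Set X)).exists_maximal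
      ⟨∅, Finset.mem_filter.2 ⟨Finset.empty_mem_powerset Z, by simp [IsSeparatedFor]⟩⟩
  obtain ⟨hWZ, hWsep⟩ : W ⊆ Z ∧ IsSeparatedFor d ε (W : Set X) := by simpa using hW.prop
  refine ⟨W, hWZ, hWsep, fun z hz => ?_⟩
  by_contra! hfar
  have hinsert : IsSeparatedFor d ε (insert z W : Finset X) := by
    rw [Finset.coe_insert]
    exact Set.pairwise_insert.2
      ⟨hWsep, fun w hw _ => ⟨hfar w hw, (hfar w hw).trans_eq (hsymm z w)⟩⟩
  have hzW : z ∈ W := hW.le_of_ge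
    (Finset.mem_filter.2 ⟨Finset.mem_powerset.2 (Finset.insert_subset hz hWZ), hinsert⟩)
    (Finset.subset_insert z W) (Finset.mem_insert_self z W)
  exact (hfar z hzW).not_gt (hself z)

lemma sepNumber_le_mul_of_forall_sepNumber_ball_le {R : ℕ∞} (hself : ∀ x, d' x x < ε')
    (hsymm : ∀ x y, d' x y = d' y x)
    (hball : ∀ w ∈ A, sepNumber {z ∈ A | d' z w < ε'} d ε ≤ R) :
    sepNumber A d ε ≤ sepNumber A d' ε' * R := by
  refine sepNumber_le_of_forall_finset fun Z hZA hZ => ?_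
  obtain ⟨W, hWZ, hWsep, hcover⟩ :=
    exists_subset_isSeparatedFor_forall_exists_lt hself hsymm Z
  have hWA : (W : Set X) ⊆ A := (Finset.coe_subset.2 hWZ).trans hZA
  have encard_inter_ball_le (w : X) (hw : w ∈ W) : {z ∈ (Z : Set X) | d' z w < ε'}.encard ≤ R :=
    (encard_le_sepNumber (A := {z ∈ A | d' z w < ε'}) (fun z hz => ⟨hZA hz.1, hz.2⟩)
      (hZ.mono fun z hz => hz.1)).trans (hball w (hWA hw))
  calc (Z : Set X).encard ≤ (⋃ w ∈ W, {z ∈ (Z : Set X) | d' z w < ε'}).encard :=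
        Set.encard_le_encard fun z hz => by simpa [Finset.mem_coe.1 hz] using hcover z hz
    _ ≤ ∑ w ∈ W, {z ∈ (Z : Set X) | d' z w < ε'}.encard := Finset.set_encard_biUnion_le _ _
    _ ≤ W.card • R := Finset.sum_le_card_nsmul _ _ _ encard_inter_ball_le
    _ = (W : Set X).encard * R := by rw [nsmul_eq_mul, Set.encard_coe_eq_coe_finsetCard]
    _ ≤ sepNumber A d' ε' * R := by gcongr; exact encard_le_sepNumber hWA hWsep

end Separated

/-! ### Closeness off a small proportion of the points -/

section MostlyClose

open scoped Finset

variable {X : Type uX} {D : Type uD} [Fintype D] {ρ ρ' : X → X → ℝ} {φ ψ χ : D → X}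
  {κ κ' θ θ' : ℝ}

/-- The maps `φ` and `ψ` are `κ`-close with respect to `ρ` at every point of `D` outside an
exceptional set of density at most `θ`. This is the form in which closeness for `rhoTwo` is
transferred between pseudometrics. -/
def IsMostlyClose (ρ : X → X → ℝ) (κ θ : ℝ) (φ ψ : D → X) : Prop :=
  ∃ E : Finset D, (#E : ℝ) ≤ θ * Fintype.card D ∧ ∀ v ∉ E, ρ (φ v) (ψ v) < κ

lemma rhoTwo_le_iff {δ : ℝ} (hδ : 0 ≤ δ) :
    rhoTwo D ρ φ ψ ≤ δ ↔ ∑ v, ρ (φ v) (ψ v) ^ 2 ≤ δ ^ 2 * Fintype.card D := by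
  rcases isEmpty_or_nonempty D with _ | _
  · simpa [rhoTwo] using hδ
  · have hcard : (0 : ℝ) < Fintype.card D := by exact_mod_cast Fintype.card_pos
    rw [rhoTwo, Real.sqrt_le_left hδ, one_div, inv_mul_le_iff₀ hcard, mul_comm]

lemma rhoInf_lt_iff [Nonempty D] {ε : ℝ} : rhoInf D ρ φ ψ < ε ↔ ∀ v, ρ (φ v) (ψ v) < ε := by
  simp [rhoInf, Finset.sup'_lt_iff]

lemma rhoInf_comm [Nonempty D] (h : IsPseudometric ρ) (φ ψ : D → X) :
    rhoInf D ρ φ ψ = rhoInf D ρ ψ φ := by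
  simp only [rhoInf, fun v => h.symmetric (φ v) (ψ v)]

namespace IsMostlyClose

lemma of_forall_lt (h : ∀ v, ρ (φ v) (ψ v) < κ) : IsMostlyClose ρ κ 0 φ ψ :=
  ⟨∅, by simp, fun v _ => h v⟩

lemma mono (h : IsMostlyClose ρ κ θ φ ψ) (hθ : θ ≤ θ') : IsMostlyClose ρ κ θ' φ ψ := by
  obtain ⟨E, hE, hlt⟩ := h
  exact ⟨E, hE.trans (by gcongr), hlt⟩

lemma symm (hρ : IsPseudometric ρ) (h : IsMostlyClose ρ κ θ φ ψ) : IsMostlyClose ρ κ θ ψ φ := by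
  obtain ⟨E, hE, hlt⟩ := h
  exact ⟨E, hE, fun v hv => hρ.symmetric (φ v) (ψ v) ▸ hlt v hv⟩

lemma trans (hρ : IsPseudometric ρ) (h : IsMostlyClose ρ κ θ φ ψ)
    (h' : IsMostlyClose ρ κ' θ' ψ χ) : IsMostlyClose ρ (κ + κ') (θ + θ') φ χ := by
  classical
  obtain ⟨E, hE, hlt⟩ := h
  obtain ⟨E', hE', hlt'⟩ := h'
  refine ⟨E ∪ E', ?_, fun v hv => ?_⟩
  · have hunion : (#(E ∪ E') : ℝ) ≤ #E + #E' := by exact_mod_cast Finset.card_union_le E E'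
    linarith
  · rw [Finset.mem_union, not_or] at hv
    linarith [hρ.triangle (φ v) (χ v) (ψ v), hlt v hv.1, hlt' v hv.2]

lemma of_rhoTwo_le (hκ : 0 < κ) (hθ : 0 ≤ θ) (h : rhoTwo D ρ φ ψ ≤ √θ * κ) :
    IsMostlyClose ρ κ θ φ ψ := by
  refine ⟨Finset.univ.filter fun v => κ ≤ ρ (φ v) (ψ v), ?_, by simp⟩
  rw [rhoTwo_le_iff (by positivity), mul_pow, Real.sq_sqrt hθ] at h
  refine le_of_mul_le_mul_right ?_ (by positivity : 0 < κ ^ 2)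
  calc (#{v | κ ≤ ρ (φ v) (ψ v)} : ℝ) * κ ^ 2
      = ∑ v with κ ≤ ρ (φ v) (ψ v), κ ^ 2 := by simp
    _ ≤ ∑ v with κ ≤ ρ (φ v) (ψ v), ρ (φ v) (ψ v) ^ 2 := by
        gcongr with v hv
        exact (Finset.mem_filter.1 hv).2
    _ ≤ ∑ v, ρ (φ v) (ψ v) ^ 2 :=
        Finset.sum_le_sum_of_subset_of_nonneg (Finset.subset_univ _) fun _ _ _ => sq_nonneg _
    _ ≤ θ * Fintype.card D * κ ^ 2 := by linarith

lemma rhoTwo_le (hρ : IsPseudometric ρ) {C : ℝ} (hC : ∀ x y, ρ x y ≤ C)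
    (h : IsMostlyClose ρ κ θ φ ψ) : rhoTwo D ρ φ ψ ≤ √(κ ^ 2 + C ^ 2 * θ) := by
  classical
  obtain ⟨E, hE, hlt⟩ := h
  have sq_le (v : D) : ρ (φ v) (ψ v) ^ 2 ≤ κ ^ 2 + if v ∈ E then C ^ 2 else 0 := by
    have hnonneg := hρ.nonneg (φ v) (ψ v)
    split_ifs with hv
    · linarith [pow_le_pow_left₀ hnonneg (hC (φ v) (ψ v)) 2, sq_nonneg κ]
    · linarith [pow_le_pow_left₀ hnonneg (hlt v hv).le 2]
  have hsum : ∑ v, ρ (φ v) (ψ v) ^ 2 ≤ (κ ^ 2 + C ^ 2 * θ) * Fintype.card D :=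
    calc ∑ v, ρ (φ v) (ψ v) ^ 2
        ≤ ∑ v, (κ ^ 2 + if v ∈ E then C ^ 2 else 0) := Finset.sum_le_sum fun v _ => sq_le v
      _ = κ ^ 2 * Fintype.card D + C ^ 2 * #E := by
          simp [Finset.sum_add_distrib, mul_comm]
      _ ≤ κ ^ 2 * Fintype.card D + C ^ 2 * (θ * Fintype.card D) := by gcongr
      _ = (κ ^ 2 + C ^ 2 * θ) * Fintype.card D := by ring
  rcases isEmpty_or_nonempty D with _ | _
  · simp [rhoTwo]
  have hcard : (0 : ℝ) < Fintype.card D := by exact_mod_cast Fintype.card_pos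
  have hpos : 0 ≤ κ ^ 2 + C ^ 2 * θ := nonneg_of_mul_nonneg_left
    ((Finset.sum_nonneg fun _ _ => sq_nonneg _).trans hsum) hcard
  rwa [rhoTwo_le_iff (Real.sqrt_nonneg _), Real.sq_sqrt hpos]

lemma comp_right {f : D → D} {Δ : ℕ} (hf : ∀ v, (f ⁻¹' {v}).ncard ≤ Δ)
    (h : IsMostlyClose ρ κ θ φ ψ) : IsMostlyClose ρ κ (Δ * θ) (φ ∘ f) (ψ ∘ f) := by
  classical
  obtain ⟨E, hE, hlt⟩ := h
  refine ⟨Finset.univ.filter fun v => f v ∈ E, ?_, fun v hv => hlt (f v) (by simpa using hv)⟩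
  have hcard : #{v | f v ∈ E} ≤ Δ * #E := by
    refine Finset.card_le_mul_card_image_of_maps_to (f := f) (by simp) Δ fun b _ => ?_
    calc #{a ∈ ({v | f v ∈ E} : Finset D) | f a = b} ≤ #{a | f a = b} := by
          gcongr; exact Finset.subset_univ _
      _ = (f ⁻¹' {b}).ncard := by rw [← Set.ncard_coe_finset]; congr 1; ext; simp
      _ ≤ Δ := hf b
  calc (#{v | f v ∈ E} : ℝ) ≤ Δ * #E := by exact_mod_cast hcard
    _ ≤ Δ * (θ * Fintype.card D) := by gcongr
    _ = Δ * θ * Fintype.card D := by ring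

lemma comp_of_hamDist_le (hρ : IsPseudometric ρ) (hκ : 0 < κ) {f g : D → D}
    (h : hamDist f g ≤ θ) (φ : D → X) : IsMostlyClose ρ κ θ (φ ∘ f) (φ ∘ g) := by
  classical
  refine ⟨Finset.univ.filter fun v => f v ≠ g v, ?_, fun v hv => ?_⟩
  · rcases isEmpty_or_nonempty D with _ | _
    · simp
    have hcard : (0 : ℝ) < Fintype.card D := by exact_mod_cast Fintype.card_pos
    rw [hamDist, div_le_iff₀ hcard] at h
    simpa only [hammingDist] using h
  · have hfg : f v = g v := by simpa using hv
    simpa [hfg, hρ.self_eq_zero] using hκ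

lemma of_forall_smul {M : Type uM} [SMul M X] {K : Finset M} {ε : ℝ}
    (hK : ∀ x y, (∀ k ∈ K, ρ (k • x) (k • y) < κ) → ρ' x y < ε)
    (h : ∀ k ∈ K, IsMostlyClose ρ κ θ (k • φ) (k • ψ)) : IsMostlyClose ρ' ε (#K * θ) φ ψ := by
  classical
  choose! E hE hlt using h
  refine ⟨K.biUnion E, ?_, fun v hv => hK _ _ fun k hk => hlt k hk v fun hvE => hv ?_⟩
  · calc (#(K.biUnion E) : ℝ) ≤ ∑ k ∈ K, (#(E k) : ℝ) := by
          exact_mod_cast Finset.card_biUnion_le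
      _ ≤ #K • (θ * Fintype.card D) := Finset.sum_le_card_nsmul _ _ _ hE
      _ = #K * θ * Fintype.card D := by rw [nsmul_eq_mul, mul_assoc]
  · exact Finset.mem_biUnion.2 ⟨k, hk, hvE⟩

end IsMostlyClose

lemma exists_sepNumber_isMostlyClose_le [TopologicalSpace X] [CompactSpace X]
    (h : IsContinuousPseudometric ρ) {ε η : ℝ} (hε : 0 < ε) (hη : 0 < η) :
    ∃ θ : ℝ, 0 < θ ∧ ∀ (D : Type uD) [Fintype D] [Nonempty D] (w : D → X),
      sepNumber {z | IsMostlyClose ρ (ε / 2) θ z w} (rhoInf D ρ) ε ≤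
        ⌊Real.exp (η * Fintype.card D)⌋₊ := by
  classical
  obtain ⟨N, c, hc⟩ := h.exists_fin_coloring hε
  obtain ⟨θ, hθ, hcount⟩ := exists_card_hammingDist_le_le_exp.{uD} (Option (Fin N)) hη
  refine ⟨θ, hθ, fun D _ _ w => ?_⟩
  -- Maps mostly close to `w` get codes in a small Hamming ball around the constant `none`.
  let code (z : D → X) (v : D) : Option (Fin N) :=
    if ρ (z v) (w v) < ε / 2 then none else some (c (z v))
  refine (sepNumber_le_card_of_mapsTo code
    {f | (hammingDist f fun _ => none : ℝ) ≤ θ * Fintype.card D} ?_ fun z z' hzz' => ?_).trans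
      (Nat.cast_le.2 (Nat.le_floor (hcount D fun _ => none)))
  · rintro z ⟨E, hE, hlt⟩
    have hsupp : hammingDist (code z) (fun _ => none) ≤ #E := by
      refine Finset.card_le_card fun v hv => ?_
      by_contra hvE
      exact (hlt v hvE).not_ge (by simpa [code] using hv)
    have hsupp' : (hammingDist (code z) (fun _ => none) : ℝ) ≤ #E := by exact_mod_cast hsupp
    simpa using hsupp'.trans hE
  · refine rhoInf_lt_iff.2 fun v => ?_
    have hv : code z v = code z' v := congrFun hzz' v
    simp only [code] at hv
    split_ifs at hv with hz hz'
    · rw [h.symmetric] at hz'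
      linarith [h.triangle (z v) (z' v) (w v)]
    · exact hc _ _ (Option.some.inj hv)

end MostlyClose

/-! ### Approximate orbits -/

section ApproximateOrbits

open scoped Finset

variable {M : Type uM} [Monoid M] {X : Type uX} [MulAction M X] {D : Type uD} [Fintype D]
  {ρ ρ' : X → X → ℝ} {σ : M → D → D} {φ ψ : D → X} {κ θ : ℝ}

lemma mapSet_mono {F F' : Finset M} {δ δ' : ℝ} (hF : F' ⊆ F) (hδ : δ ≤ δ') :
    mapSet ρ F δ σ ⊆ mapSet ρ F' δ' σ :=
  fun _ hφ m hm => (hφ m (hF hm)).trans hδ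

lemma isMostlyClose_of_mem_mapSet {F : Finset M} (hκ : 0 < κ) (hθ : 0 ≤ θ)
    (hφ : φ ∈ mapSet ρ F (√θ * κ) σ) {m : M} (hm : m ∈ F) :
    IsMostlyClose ρ κ θ (φ ∘ σ m) (m • φ) :=
  .of_rhoTwo_le hκ hθ (hφ m hm)

lemma isMostlyClose_smul_comp (hρ : IsPseudometric ρ) (hκ : 0 < κ) {k m : M} {Δ : ℕ}
    (hfiber : ∀ v, (σ m ⁻¹' {v}).ncard ≤ Δ) (hmul : hamDist (σ (k * m)) (σ k ∘ σ m) ≤ θ)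
    (hk : IsMostlyClose ρ κ θ (φ ∘ σ k) (k • φ))
    (hkm : IsMostlyClose ρ κ θ (φ ∘ σ (k * m)) ((k * m) • φ)) :
    IsMostlyClose ρ (κ + κ + κ) (Δ * θ + θ + θ) (k • (φ ∘ σ m)) (k • m • φ) := by
  have hk_comp : IsMostlyClose ρ κ (Δ * θ) (k • (φ ∘ σ m)) (φ ∘ (σ k ∘ σ m)) :=
    (hk.symm hρ).comp_right hfiber
  have hmul_comp : IsMostlyClose ρ κ θ (φ ∘ (σ k ∘ σ m)) (φ ∘ σ (k * m)) :=
    (IsMostlyClose.comp_of_hamDist_le hρ hκ hmul φ).symm hρ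
  exact (hk_comp.trans hρ hmul_comp).trans hρ (mul_smul k m φ ▸ hkm)

lemma isMostlyClose_of_rhoInf_lt [Nonempty D] (hρ : IsPseudometric ρ) {K : Finset M} {ε : ℝ}
    (hκ : 0 < κ) (hθ : 0 ≤ θ) (hK : ∀ x y, (∀ k ∈ K, ρ (k • x) (k • y) < κ + κ + κ) → ρ' x y < ε)
    (hφ : φ ∈ mapSet ρ K (√θ * κ) σ) (hψ : ψ ∈ mapSet ρ K (√θ * κ) σ)
    (hφψ : rhoInf D ρ φ ψ < κ) : IsMostlyClose ρ' ε (#K * (2 * θ)) φ ψ := by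
  refine .of_forall_smul hK fun k hk => ?_
  have hφψ_comp : IsMostlyClose ρ κ 0 (φ ∘ σ k) (ψ ∘ σ k) :=
    .of_forall_lt fun v => rhoInf_lt_iff.1 hφψ (σ k v)
  have hφk : IsMostlyClose ρ κ θ (k • φ) (φ ∘ σ k) :=
    (isMostlyClose_of_mem_mapSet hκ hθ hφ hk).symm hρ
  have hψk : IsMostlyClose ρ κ θ (ψ ∘ σ k) (k • ψ) := isMostlyClose_of_mem_mapSet hκ hθ hψ hk
  exact ((hφk.trans hρ hφψ_comp).trans hρ hψk).mono (by linarith)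

end ApproximateOrbits

/-- The net `S` is asymptotically multiplicative and its maps have eventually uniformly bounded
fibres. These are the properties of a strong sofic approximation that make the sofic entropy
independent of the pseudometric; neither units nor asymptotic freeness are involved. -/
structure SoficNet.IsBoundedFiberApproximation {M : Type uM} [Monoid M] {I : Type uI} [Preorder I]
    (S : SoficNet.{uM, uI, uD} M I) : Prop where
  tendsto_mul : ∀ m₁ m₂ : M,
    Tendsto (fun i => hamDist (S.σ i (m₁ * m₂)) (S.σ i m₁ ∘ S.σ i m₂)) atTop (𝓝 0)
  fiber_bound : ∀ m : M, ∃ Δ : ℕ, ∀ᶠ i in atTop, ∀ v : S.D i, (S.σ i m ⁻¹' {v}).ncard ≤ Δ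

lemma SoficNet.IsStrongSoficApproximation.isBoundedFiberApproximation {M : Type uM} [Monoid M]
    {I : Type uI} [Preorder I] {S : SoficNet.{uM, uI, uD} M I}
    (hS : S.IsStrongSoficApproximation) : S.IsBoundedFiberApproximation where
  tendsto_mul := hS.tendsto_mul
  fiber_bound m :=
    let ⟨Δ, _, hΔ⟩ := hS.fiber_bound {m}
    ⟨Δ, .of_forall fun i => hΔ i m (Finset.mem_singleton_self m)⟩

section BoundedFiberApproximation

open scoped Finset

variable {M : Type uM} [Monoid M] {X : Type uX} [MulAction M X] {I : Type uI} [Preorder I]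
  {S : SoficNet.{uM, uI, uD} M I} {ρ ρ' : X → X → ℝ}

lemma SoficNet.IsBoundedFiberApproximation.exists_fiber_bound
    (hS : S.IsBoundedFiberApproximation) (F : Finset M) :
    ∃ Δ : ℕ, ∀ᶠ i in atTop, ∀ m ∈ F, ∀ v : S.D i, (S.σ i m ⁻¹' {v}).ncard ≤ Δ := by
  choose Δ hΔ using hS.fiber_bound
  refine ⟨F.sup Δ, (Filter.eventually_all_finset F).2 fun m hm => ?_⟩
  exact (hΔ m).mono fun i hi v => (hi v).trans (Finset.le_sup hm)

variable [TopologicalSpace X] [CompactSpace X] [ContinuousConstSMul M X]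

lemma SoficNet.IsBoundedFiberApproximation.eventually_mapSet_subset
    (hS : S.IsBoundedFiberApproximation) (h : IsGenPseudometric M ρ)
    (h' : IsContinuousPseudometric ρ') (F' : Finset M) {δ' : ℝ} (hδ' : 0 < δ') :
    ∃ (F : Finset M) (δ : ℝ), 0 < δ ∧
      ∀ᶠ i in atTop, mapSet ρ F δ (S.σ i) ⊆ mapSet ρ' F' δ' (S.σ i) := by
  classical
  obtain ⟨C, hC⟩ := h'.exists_bound
  obtain ⟨K, κ, hκ, hK⟩ := h.exists_finset_forall_smul_lt_imp_lt h' (half_pos hδ')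
  obtain ⟨Δ, hΔ⟩ := hS.exists_fiber_bound F'
  obtain ⟨θ, hθ, hθδ'⟩ :=
    exists_pos_mul_lt (by positivity : 0 < δ' ^ 2 / 2) (C ^ 2 * (#K * (Δ + 2)))
  have hmul : ∀ᶠ i in atTop, ∀ k ∈ K, ∀ m ∈ F',
      hamDist (S.σ i (k * m)) (S.σ i k ∘ S.σ i m) ≤ θ :=
    (Filter.eventually_all_finset K).2 fun k _ => (Filter.eventually_all_finset F').2 fun m _ =>
      (hS.tendsto_mul k m).eventually_le_const hθ
  refine ⟨K ∪ Finset.image₂ (· * ·) K F', √θ * (κ / 3), by positivity, ?_⟩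
  filter_upwards [hΔ, hmul] with i hΔi hmuli φ hφ m hm
  have hclose : IsMostlyClose ρ' (δ' / 2) (#K * (Δ * θ + θ + θ)) (φ ∘ S.σ i m) (m • φ) := by
    refine .of_forall_smul hK fun k hk => add_thirds κ ▸ ?_
    have hφ_close {l : M} := isMostlyClose_of_mem_mapSet (m := l) (by positivity) hθ.le hφ
    exact isMostlyClose_smul_comp h.toIsPseudometric (by positivity) (hΔi m hm) (hmuli k hk m hm)
      (hφ_close (Finset.mem_union_left _ hk))
      (hφ_close (Finset.mem_union_right _ (Finset.mem_image₂_of_mem hk hm)))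
  refine (hclose.rhoTwo_le h'.toIsPseudometric hC).trans ((Real.sqrt_le_left hδ'.le).2 ?_)
  linarith [sq_nonneg δ']

end BoundedFiberApproximation

/-! ### Independence of the pseudometric -/

section Independence

lemma log_div_le_log_div_add {a b : ℕ∞} {n : ℕ} (hn : 0 < n) {η : ℝ}
    (h : a ≤ b * ⌊Real.exp (η * n)⌋₊) :
    ENNReal.log a / (n : EReal) ≤ ENNReal.log b / (n : EReal) + η := by
  have hexp : (a : ENNReal) ≤ b * ENNReal.ofReal (Real.exp (η * n)) :=
    calc (a : ENNReal) ≤ b * (⌊Real.exp (η * n)⌋₊ : ENNReal) := by exact_mod_cast h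
      _ ≤ b * ENNReal.ofReal (Real.exp (η * n)) := by
          rw [← ENNReal.ofReal_natCast]
          gcongr
          exact Nat.floor_le (Real.exp_nonneg _)
  have hlog : ENNReal.log a ≤ ENNReal.log b + (η * n : ℝ) := by
    simpa only [ENNReal.log_mul_add, ENNReal.log_ofReal_of_pos (Real.exp_pos _), Real.log_exp]
      using ENNReal.log_monotone hexp
  have hn' : (n : ℝ) ≠ 0 := by exact_mod_cast hn.ne'
  have hn₀ : (0 : EReal) ≤ n := by positivity
  calc ENNReal.log a / (n : EReal) ≤ (ENNReal.log b + (η * n : ℝ)) / (n : EReal) :=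
        EReal.div_le_div_right_of_nonneg hn₀ hlog
    _ = ENNReal.log b / (n : EReal) + ((η * n / n : ℝ) : EReal) := by
        rw [EReal.add_div_of_nonneg_right hn₀, EReal.coe_div, EReal.coe_natCast]
    _ = ENNReal.log b / (n : EReal) + η := by rw [mul_div_cancel_right₀ η hn']

lemma le_of_forall_pos_le_add_coe {x y : EReal} (h : ∀ η : ℝ, 0 < η → x ≤ y + η) : x ≤ y := by
  refine EReal.le_of_forall_lt_iff_le.1 fun a ha => ?_
  obtain ⟨b, hyb, hba⟩ := EReal.lt_iff_exists_real_btwn.1 ha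
  calc x ≤ y + (a - b : ℝ) := h _ (sub_pos.2 (EReal.coe_lt_coe_iff.1 hba))
    _ ≤ b + (a - b : ℝ) := by gcongr
    _ = a := by rw [← EReal.coe_add, add_sub_cancel]

lemma limsup_le_limsup_add_const {α : Type*} {f : Filter α} [f.NeBot] {u v : α → EReal} {η : ℝ}
    (h : ∀ᶠ a in f, u a ≤ v a + η) : limsup u f ≤ limsup v f + η := by
  refine (limsup_le_limsup h).trans ((EReal.limsup_add_le (.inr ?_) (.inr ?_)).trans_eq ?_) <;>
    simp

variable {M : Type uM} [Monoid M] {X : Type uX} [TopologicalSpace X] [CompactSpace X]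
  [MulAction M X] [ContinuousConstSMul M X] {I : Type uI} [Preorder I]
  {S : SoficNet.{uM, uI, uD} M I} {ρ ρ' : X → X → ℝ}

open scoped Finset in
lemma exists_sepNumber_mapSet_le (h : IsContinuousPseudometric ρ) (h' : IsGenPseudometric M ρ')
    {ε : ℝ} (hε : 0 < ε) :
    ∃ (K : Finset M) (ε' : ℝ), 0 < ε' ∧ ∀ η : ℝ, 0 < η → ∃ δ : ℝ, 0 < δ ∧
      ∀ (D : Type uD) [Fintype D] [Nonempty D] (σ : M → D → D), ∀ A ⊆ mapSet ρ' K δ σ,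
        sepNumber A (rhoInf D ρ) ε ≤
          sepNumber A (rhoInf D ρ') ε' * ⌊Real.exp (η * Fintype.card D)⌋₊ := by
  obtain ⟨K, κ, hκ, hK⟩ := h'.exists_finset_forall_smul_lt_imp_lt h (half_pos hε)
  refine ⟨K, κ / 3, by positivity, fun η hη => ?_⟩
  obtain ⟨θ₀, hθ₀, hball⟩ := exists_sepNumber_isMostlyClose_le.{uX, uD} h hε hη
  obtain ⟨θ, hθ, hθθ₀⟩ := exists_pos_mul_lt hθ₀ (2 * #K)
  refine ⟨√θ * (κ / 3), by positivity, fun D _ _ σ A hA => ?_⟩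
  refine sepNumber_le_mul_of_forall_sepNumber_ball_le
    (fun φ => rhoInf_lt_iff.2 fun v => by rw [h'.self_eq_zero]; positivity)
    (rhoInf_comm h'.toIsPseudometric) fun w hw => ?_
  refine (sepNumber_mono fun z hz => ?_).trans (hball D w)
  have hzw := isMostlyClose_of_rhoInf_lt h'.toIsPseudometric (by positivity) hθ.le
    (by simpa only [add_thirds] using hK) (hA hz.1) (hA hw) hz.2
  exact hzw.mono (by linarith)

variable [IsDirectedOrder I] [Nonempty I]

lemma exists_entropyAux_le_add (hS : S.IsBoundedFiberApproximation) (h : IsGenPseudometric M ρ)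
    (h' : IsGenPseudometric M ρ') {ε : ℝ} (hε : 0 < ε) :
    ∃ ε' : ℝ, 0 < ε' ∧ ∀ η : ℝ, 0 < η → ∀ (F' : Finset M) (δ' : ℝ), 0 < δ' →
      ∃ (F : Finset M) (δ : ℝ), 0 < δ ∧
        entropyAux S ρ ε F δ ≤ entropyAux S ρ' ε' F' δ' + η := by
  classical
  obtain ⟨K, ε', hε', hexists⟩ :=
    exists_sepNumber_mapSet_le.{uM, uX, uD} h.toIsContinuousPseudometric h' hε
  refine ⟨ε', hε', fun η hη F' δ' hδ' => ?_⟩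
  obtain ⟨δ₀, hδ₀, hsep⟩ := hexists η hη
  obtain ⟨F, δ, hδ, hsub⟩ := hS.eventually_mapSet_subset h h'.toIsContinuousPseudometric
    (F' ∪ K) (lt_min hδ' hδ₀)
  refine ⟨F, δ, hδ, limsup_le_limsup_add_const (hsub.mono fun i hi => ?_)⟩
  have hsubF' := hi.trans (mapSet_mono Finset.subset_union_left (min_le_left δ' δ₀))
  have hsubK := hi.trans (mapSet_mono Finset.subset_union_right (min_le_right δ' δ₀))
  refine log_div_le_log_div_add Fintype.card_pos ((hsep (S.D i) (S.σ i) _ hsubK).trans ?_)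
  gcongr
  exact sepNumber_mono hsubF'

lemma relSoficEntropy_le (hS : S.IsBoundedFiberApproximation) (h : IsGenPseudometric M ρ)
    (h' : IsGenPseudometric M ρ') : relSoficEntropy S ρ ≤ relSoficEntropy S ρ' := by
  refine iSup₂_le fun ε hε => ?_
  obtain ⟨ε', hε', hle⟩ := exists_entropyAux_le_add hS h h' hε
  refine le_iSup₂_of_le ε' hε' (le_iInf fun F' => le_iInf₂ fun δ' hδ' =>
    le_of_forall_pos_le_add_coe fun η hη => ?_)
  obtain ⟨F, δ, hδ, hFδ⟩ := hle η hη F' δ' hδ'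
  exact iInf_le_of_le F (iInf₂_le_of_le δ hδ hFδ)

lemma relSoficEntropy_eq (hS : S.IsBoundedFiberApproximation) (h : IsGenPseudometric M ρ)
    (h' : IsGenPseudometric M ρ') : relSoficEntropy S ρ = relSoficEntropy S ρ' :=
  (relSoficEntropy_le hS h h').antisymm (relSoficEntropy_le hS h' h)

end Independence

/-! ### Invariance under conjugacy -/

section Conjugacy

open scoped Function

variable {X : Type uX} {Y : Type uY} {ρ : X → X → ℝ} {g : Y → X}

lemma sepNumber_comap_le (hg : Function.Injective g) {A : Set Y} {B : Set X}
    (hAB : Set.MapsTo g A B) (ε : ℝ) : sepNumber A (ρ on g) ε ≤ sepNumber B ρ ε := by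
  refine iSup_le fun Z => iSup₂_le fun hZA hZ => ?_
  rw [← hg.encard_image]
  refine encard_le_sepNumber (hAB.mono_left hZA).image_subset ?_
  exact Set.Pairwise.image hZ

variable {M : Type uM} [Monoid M] [MulAction M X] [MulAction M Y]

lemma IsGenPseudometric.comap [TopologicalSpace X] [TopologicalSpace Y]
    (h : IsGenPseudometric M ρ) (hg : Continuous g) (hinj : Function.Injective g)
    (hequiv : ∀ (m : M) y, g (m • y) = m • g y) : IsGenPseudometric M (ρ on g) where
  self_eq_zero _ := h.self_eq_zero _
  symmetric _ _ := h.symmetric _ _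
  triangle _ _ _ := h.triangle _ _ _
  continuous := h.continuous.comp (by fun_prop : Continuous fun p : Y × Y => (g p.1, g p.2))
  generating y y' hne := by
    simpa only [Function.onFun, hequiv] using h.generating _ _ (hinj.ne hne)

lemma relSoficEntropy_comap_le {I : Type uI} [Preorder I] (S : SoficNet.{uM, uI, uD} M I)
    (ρ : X → X → ℝ) (hinj : Function.Injective g) (hequiv : ∀ (m : M) y, g (m • y) = m • g y) :
    relSoficEntropy S (ρ on g) ≤ relSoficEntropy S ρ := by
  refine iSup₂_mono fun ε _ => iInf_mono fun F => iInf₂_mono fun δ _ =>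
    limsup_le_limsup (Eventually.of_forall fun i => ?_)
  have hmaps : Set.MapsTo (g ∘ ·) (mapSet (ρ on g) F δ (S.σ i)) (mapSet ρ F δ (S.σ i)) :=
    fun φ hφ m hm => by
      simpa only [rhoTwo, Function.onFun, Function.comp_apply, hequiv] using hφ m hm
  have hsep : sepNumber (mapSet (ρ on g) F δ (S.σ i)) (rhoInf (S.D i) (ρ on g)) ε ≤
      sepNumber (mapSet ρ F δ (S.σ i)) (rhoInf (S.D i) ρ) ε := by
    have hrhoInf : rhoInf (S.D i) (ρ on g) = (rhoInf (S.D i) ρ on (g ∘ ·)) := rfl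
    rw [hrhoInf]
    exact sepNumber_comap_le hinj.comp_left hmaps ε
  exact EReal.div_le_div_right_of_nonneg (by positivity)
    (ENNReal.log_monotone (by exact_mod_cast hsep))

lemma relSoficEntropy_comap_equiv {I : Type uI} [Preorder I] (S : SoficNet.{uM, uI, uD} M I)
    (ρ : X → X → ℝ) (e : Y ≃ X) (hequiv : ∀ (m : M) y, e (m • y) = m • e y) :
    relSoficEntropy S (ρ on e) = relSoficEntropy S ρ := by
  refine (relSoficEntropy_comap_le S ρ e.injective hequiv).antisymm ?_
  have hsymm (m : M) (x : X) : e.symm (m • x) = m • e.symm x := by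
    rw [e.symm_apply_eq, hequiv, e.apply_symm_apply]
  have hcomap : ((ρ on e) on e.symm) = ρ := by
    ext x y
    simp only [Function.onFun, e.apply_symm_apply]
  simpa only [hcomap] using relSoficEntropy_comap_le S (ρ on e) e.symm.injective hsymm

end Conjugacy

open scoped Function in
theorem mainTheorem4_general {M : Type uM} [Monoid M]
    {X : Type uX} [TopologicalSpace X] [CompactSpace X] [MulAction M X] [ContinuousConstSMul M X]
    {Y : Type uY} [TopologicalSpace Y] [CompactSpace Y] [MulAction M Y] [ContinuousConstSMul M Y]
    (hconj : TopologicallyConjugate M X Y) (hX : AdmitsGenPseudometric M X) :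
    ∃ hY : AdmitsGenPseudometric M Y,
      ∀ {I : Type uI} [Preorder I] [IsDirectedOrder I] [Nonempty I]
        (S : SoficNet.{uM, uI, uD} M I), S.IsBoundedFiberApproximation →
        (∀ ρ : X → X → ℝ, IsGenPseudometric M ρ → relSoficEntropy S ρ = soficEntropy S hX) ∧
        (∀ ρ : Y → Y → ℝ, IsGenPseudometric M ρ → relSoficEntropy S ρ = soficEntropy S hY) ∧
        soficEntropy S hX = soficEntropy S hY := by
  obtain ⟨f, hf⟩ := hconj
  have hf_symm (m : M) (y : Y) : f.symm (m • y) = m • f.symm y := f.injective (by simp [hf])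
  have hρY : IsGenPseudometric M (hX.choose on f.symm) :=
    hX.choose_spec.comap f.symm.continuous f.symm.injective hf_symm
  let hY : AdmitsGenPseudometric M Y := ⟨_, hρY⟩
  refine ⟨hY, fun S hS => ⟨fun ρ hρ => relSoficEntropy_eq hS hρ hX.choose_spec,
    fun ρ hρ => relSoficEntropy_eq hS hρ hY.choose_spec, ?_⟩⟩
  calc soficEntropy S hX = relSoficEntropy S (hX.choose on f.symm) :=
        (relSoficEntropy_comap_equiv S hX.choose f.symm.toEquiv hf_symm).symm
    _ = soficEntropy S hY := relSoficEntropy_eq hS hρY hY.choose_spec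

theorem mainTheorem4 {M : Type uM} [Monoid M] [Infinite M] (hM : StronglySofic M)
    {X : Type uX} [TopologicalSpace X] [CompactSpace X] [MulAction M X] [ContinuousConstSMul M X]
    {Y : Type uY} [TopologicalSpace Y] [CompactSpace Y] [MulAction M Y] [ContinuousConstSMul M Y]
    (hconj : TopologicallyConjugate M X Y) (hX : AdmitsGenPseudometric M X) :
    ∃ hY : AdmitsGenPseudometric M Y,
      ∀ {I : Type uI} [Preorder I] [IsDirectedOrder I] [Nonempty I]
        (S : SoficNet.{uM, uI, uD} M I), S.IsStrongSoficApproximation →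
        (∀ ρ : X → X → ℝ, IsGenPseudometric M ρ → relSoficEntropy S ρ = soficEntropy S hX) ∧
        (∀ ρ : Y → Y → ℝ, IsGenPseudometric M ρ → relSoficEntropy S ρ = soficEntropy S hY) ∧
        soficEntropy S hX = soficEntropy S hY := by
  obtain ⟨hY, h⟩ := mainTheorem4_general.{uM, uX, uY, uI, uD} hconj hX
  exact ⟨hY, fun S hS => h S hS.isBoundedFiberApproximation⟩
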